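/- For a number field $K$ let $V_K$ be the set of all places of $K$, $V_K^f\subseteq V_K$ the set of finite (non-archimedean) places, $\mathbb{A}_K$ the ring of adeles of $K$ and $\mathbb{A}_K^{fin}$ the ring of finite adeles, i.e. the restricted product of the completions $K_v$, $v\in V_K^f$, with respect to their valuation rings. The support of $a\in\mathbb{A}_K$ is $\{v\in V_K: a(v)\neq 0\}$, and the support of $a\in\mathbb{A}_K^{fin}$ is $\{v\in V_K^f: a(v)\neq 0\}$. Let $\mathbb{F}_K$ be the ideal, in the Boolean algebra of idempotents of $\mathbb{A}_K$, of the idempotents with finite support, and let $\mathbb{F}_K^{fin}$ be the ideal, in the Boolean algebra of idempotents of $\mathbb{A}_K^{fin}$, of the idempotents with finite support. An $\exists\forall\exists$-formula is a formula $\exists\bar x\,\forall\bar y\,\exists\bar z\,\theta$, with $\theta$ quantifier-free and with finite, possibly empty, blocks of quantifiers. Theorem 3.2. There is an $\exists\forall\exists$-formula $\varphi(x)$, without parameters, in the language of rings such that for every number field $K$ $$\mathbb{F}_K=\{a\in\mathbb{A}_K : \mathbb{A}_K\models\varphi(a)\}.$$ Likewise there is an $\exists\forall\exists$-formula $\psi(x)$,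 without parameters, in the language of rings such that for every number field $K$ $$\mathbb{F}_K^{fin}=\{a\in\mathbb{A}_K^{fin} : \mathbb{A}_K^{fin}\models\psi(a)\}.$$ -/

import Mathlib

universe u

namespace FirstOrder.Language.BoundedFormula

/-- A `∀∃` formula: a (possibly empty) block of universal quantifiers in front of an existential
formula. -/
inductive IsForallExists {L : FirstOrder.Language} {α : Type*} :
    ∀ {n : ℕ}, L.BoundedFormula α n → Prop
  | of_isExistential {n : ℕ} {φ : L.BoundedFormula α n} (h : φ.IsExistential) : IsForallExists φ
  | all {n : ℕ} {φ : L.BoundedFormula α (n + 1)} (h : IsForallExists φ) : IsForallExists φ.all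

/-- An `∃∀∃` formula: a (possibly empty) block of existential quantifiers in front of a
`∀∃` formula. -/
inductive IsExistsForallExists {L : FirstOrder.Language} {α : Type*} :
    ∀ {n : ℕ}, L.BoundedFormula α n → Prop
  | of_isForallExists {n : ℕ} {φ : L.BoundedFormula α n} (h : φ.IsForallExists) :
      IsExistsForallExists φ
  | ex {n : ℕ} {φ : L.BoundedFormula α (n + 1)} (h : IsExistsForallExists φ) :
      IsExistsForallExists φ.ex

end FirstOrder.Language.BoundedFormula

/-- The parameter-free formula `φ(x)` of the language of rings defines the subset `S` of the
commutative ring `R` (with its own ring operations as the interpretation of the symbols). -/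
def FirstOrder.Ring.Defines (φ : FirstOrder.Language.ring.Formula (Fin 1))
    (R : Type*) [CommRing R] (S : Set R) : Prop :=
  letI := FirstOrder.Ring.compatibleRingOfRing R
  ∀ a : R, φ.Realize ![a] ↔ a ∈ S

namespace AdelicIdempotents

open NumberField IsDedekindDomain

/-- The support of a finite adele: the set of finite places where its component is nonzero. -/
def finiteSupp {K : Type*} [Field K] [NumberField K] (a : FiniteAdeleRing (𝓞 K) K) :
    Set (HeightOneSpectrum (𝓞 K)) :=
  {v | a v ≠ 0}

/-- The support of an adele: the set of all (infinite or finite) places where its component is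
nonzero. -/
def supp {K : Type*} [Field K] [NumberField K] (a : AdeleRing (𝓞 K) K) :
    Set (InfinitePlace K ⊕ HeightOneSpectrum (𝓞 K)) :=
  {v | Sum.elim (fun w => a.1 w ≠ 0) (fun w => a.2 w ≠ 0) v}

/-- The ideal of finite-support idempotents of the finite adele ring, as an ideal of the
Boolean algebra of all idempotents (`e ≤ f ↔ e * f = e`, `e ⊔ f = e + f - e * f`). -/
def finFinite (K : Type*) [Field K] [NumberField K] :
    Order.Ideal {e : FiniteAdeleRing (𝓞 K) K // IsIdempotentElem e} where
  carrier := {e | (finiteSupp e.1).Finite}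
  lower' := by
    intro f e h hf
    refine Set.Finite.subset hf fun v hv hfv => hv ?_
    have h1 : e.1 * f.1 = e.1 := h
    have h2 : (e.1 * f.1) v = e.1 v * f.1 v := rfl
    rw [← h1, h2, hfv, mul_zero]
  nonempty' := by
    refine ⟨⊥, ?_⟩
    have : finiteSupp (0 : FiniteAdeleRing (𝓞 K) K) = ∅ :=
      Set.eq_empty_of_forall_notMem fun v hv => hv rfl
    change (finiteSupp (0 : FiniteAdeleRing (𝓞 K) K)).Finite
    rw [this]
    exact Set.finite_empty
  directed' := by
    intro e he f hf
    refine ⟨e ⊔ f, ?_, le_sup_left, le_sup_right⟩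
    refine Set.Finite.subset (Set.Finite.union he hf) fun v hv => ?_
    by_contra hc
    simp only [finiteSupp, Set.mem_union, Set.mem_ofPred_eq, not_or, not_not] at hc
    refine hv ?_
    change e.1 v + f.1 v - e.1 v * f.1 v = 0
    rw [hc.1, hc.2]
    ring

/-- The ideal of finite-support idempotents of the adele ring, as an ideal of the
Boolean algebra of all idempotents (`e ≤ f ↔ e * f = e`, `e ⊔ f = e + f - e * f`). -/
def fin (K : Type*) [Field K] [NumberField K] :
    Order.Ideal {e : AdeleRing (𝓞 K) K // IsIdempotentElem e} where
  carrier := {e | (supp e.1).Finite}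
  lower' := by
    intro f e h hf
    refine Set.Finite.subset hf fun v hv => ?_
    have h1 : e.1 * f.1 = e.1 := h
    rcases v with v | v
    · intro hfv
      refine hv ?_
      have h2 : (e.1 * f.1).1 v = e.1.1 v * f.1.1 v := rfl
      have h3 : f.1.1 v = 0 := hfv
      rw [← h1, h2, h3, mul_zero]
    · intro hfv
      refine hv ?_
      have h2 : (e.1 * f.1).2 v = e.1.2 v * f.1.2 v := rfl
      have h3 : f.1.2 v = 0 := hfv
      rw [← h1, h2, h3, mul_zero]
  nonempty' := by
    refine ⟨⊥, ?_⟩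
    have : supp (0 : AdeleRing (𝓞 K) K) = ∅ :=
      Set.eq_empty_of_forall_notMem fun v hv => by
        rcases v with v | v
        · exact hv rfl
        · exact hv rfl
    change (supp (0 : AdeleRing (𝓞 K) K)).Finite
    rw [this]
    exact Set.finite_empty
  directed' := by
    intro e he f hf
    refine ⟨e ⊔ f, ?_, le_sup_left, le_sup_right⟩
    refine Set.Finite.subset (Set.Finite.union he hf) fun v hv => ?_
    by_contra hc
    simp only [supp, Set.mem_union, Set.mem_ofPred_eq, not_or] at hc
    rcases v with v | v
    · simp only [Sum.elim_inl, not_not] at hc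
      refine hv ?_
      change e.1.1 v + f.1.1 v - e.1.1 v * f.1.1 v = 0
      rw [hc.1, hc.2]
      ring
    · simp only [Sum.elim_inr, not_not] at hc
      refine hv ?_
      change e.1.2 v + f.1.2 v - e.1.2 v * f.1.2 v = 0
      rw [hc.1, hc.2]
      ring

end AdelicIdempotents

namespace AdelicIdempotents

open NumberField IsDedekindDomain FirstOrder FirstOrder.Language

/-! An idempotent `e` has finite support exactly when the ring it cuts out is von Neumann regular.
Over a finite support that ring is a finite product of fields, where componentwise inverses serve as
quasi-inverses. Over an infinite support, take `y` to be a uniformizer at every finite place: a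
quasi-inverse must equal `π v⁻¹` throughout the finite part of the support, so it is non-integral at
infinitely many places and is not an adele. Infinite places are finitely many, with fields as
completions, so one formula serves both rings. -/

/-- The `∀∃` formula `∀ y, ∃ z, x * x = x ∧ x * (y * y * z) = x * y`, which says that `x` is
idempotent and that the ring cut out by `x` is von Neumann regular. -/
def vonNeumannRegularFormula : Language.ring.Formula (Fin 1) :=
  let x : Language.ring.Term (Fin 1 ⊕ Fin 2) := Term.var (Sum.inl 0)
  let y : Language.ring.Term (Fin 1 ⊕ Fin 2) := Term.var (Sum.inr 0)
  let z : Language.ring.Term (Fin 1 ⊕ Fin 2) := Term.var (Sum.inr 1)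
  BoundedFormula.all (BoundedFormula.ex
    (Term.bdEqual (x * x) x ⊓ Term.bdEqual (x * (y * y * z)) (x * y)))

theorem isExistsForallExists_vonNeumannRegularFormula :
    BoundedFormula.IsExistsForallExists vonNeumannRegularFormula :=
  .of_isForallExists (.all (.of_isExistential (.ex (.of_isQF
    ((BoundedFormula.IsAtomic.equal _ _).isQF.inf (BoundedFormula.IsAtomic.equal _ _).isQF)))))

theorem defines_vonNeumannRegularFormula (R : Type*) [CommRing R] :
    FirstOrder.Ring.Defines vonNeumannRegularFormula R
      {a | IsIdempotentElem a ∧ ∀ y, ∃ z, a * (y * y * z) = a * y} := by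
  let _ := FirstOrder.Ring.compatibleRingOfRing R
  intro a
  have h : vonNeumannRegularFormula.Realize ![a] ↔
      ∀ y : R, ∃ z : R, a * a = a ∧ a * (y * y * z) = a * y := by
    simp [vonNeumannRegularFormula, Formula.Realize, Fin.snoc]
  rw [h]
  simp only [exists_and_left, Set.mem_ofPred_eq, IsIdempotentElem]
  -- Idempotency sits under `∀ y` to keep the formula prenex; any instance of `y`, here `0`,
  -- recovers it.
  exact ⟨fun h => ⟨(h 0).1, fun y => (h y).2⟩, fun h y => ⟨h.1, h.2 y⟩⟩

variable {K : Type*} [Field K] [NumberField K]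

theorem exists_quasiInverse_of_finite_finiteSupp {e : FiniteAdeleRing (𝓞 K) K}
    (he : (finiteSupp e).Finite) (y : FiniteAdeleRing (𝓞 K) K) :
    ∃ z, e * (y * y * z) = e * y := by
  classical
  -- Zero off the support makes `z` integral at almost all places; on it, `0⁻¹ = 0` covers the zeros
  -- of `y`.
  refine ⟨⟨fun v => if e v = 0 then 0 else (y v)⁻¹, ?_⟩, ?_⟩
  · refine Set.Finite.subset he fun v hv hev => hv ?_
    simp [hev, zero_mem]
  · refine FiniteAdeleRing.ext _ fun v => ?_
    change e v * (y v * y v * (if e v = 0 then 0 else (y v)⁻¹)) = e v * y v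
    split_ifs with hev
    · simp [hev]
    · rw [mul_self_mul_inv]

theorem finite_finiteSupp_of_forall_exists_quasiInverse {e : FiniteAdeleRing (𝓞 K) K}
    (he : ∀ y, ∃ z, e * (y * y * z) = e * y) : (finiteSupp e).Finite := by
  choose π hπ using fun v : HeightOneSpectrum (𝓞 K) => v.valuation_exists_uniformizer K
  have hval (v : HeightOneSpectrum (𝓞 K)) :
      Valued.v (π v : v.adicCompletion K) = WithZero.exp (-1 : ℤ) := by
    rw [HeightOneSpectrum.valuedAdicCompletion_eq_valuation', hπ]
  have hlt : WithZero.exp (-1 : ℤ) < 1 := by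
    rw [← WithZero.exp_zero]
    exact WithZero.exp_lt_exp.2 (by norm_num)
  obtain ⟨z, hz⟩ := he ⟨fun v => (π v : v.adicCompletion K), Filter.Eventually.of_forall fun v => by
    rw [SetLike.mem_coe, HeightOneSpectrum.mem_adicCompletionIntegers, hval]
    exact hlt.le⟩
  -- The support lies in the finite set of places where `z` is not integral: at any other place of
  -- the support, `π v * z v = 1` would have valuation below 1.
  refine Set.Finite.subset z.2 fun v hv hzv => ?_
  have h1 : e v * ((π v : v.adicCompletion K) * (π v : v.adicCompletion K) * z v) =
      e v * (π v : v.adicCompletion K) := DFunLike.congr_fun hz v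
  have h2 := mul_left_cancel₀ hv h1
  have hπ0 : (π v : v.adicCompletion K) ≠ 0 := by
    intro h0
    have := hval v
    rw [h0, map_zero] at this
    exact WithZero.exp_ne_zero this.symm
  rw [mul_assoc] at h2
  have h3 : (π v : v.adicCompletion K) * z v = 1 :=
    mul_left_cancel₀ hπ0 (h2.trans (mul_one _).symm)
  have h4 := congrArg Valued.v h3
  rw [map_mul, map_one, hval] at h4
  have hz1 : Valued.v (z v) ≤ 1 := hzv
  exact absurd h4 (mul_lt_one_of_lt_of_le hlt hz1).ne

theorem finite_supp_iff {e : AdeleRing (𝓞 K) K} :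
    (supp e).Finite ↔ (finiteSupp e.2).Finite := by
  constructor
  · exact fun h => h.preimage Sum.inr_injective.injOn
  · intro h
    refine Set.Finite.subset ((Set.finite_range Sum.inl).union (h.image Sum.inr)) ?_
    rintro (v | v) hv
    · exact Or.inl ⟨v, rfl⟩
    · exact Or.inr ⟨v, hv, rfl⟩

theorem finite_finiteSupp_iff {e : FiniteAdeleRing (𝓞 K) K} :
    (finiteSupp e).Finite ↔ ∀ y, ∃ z, e * (y * y * z) = e * y :=
  ⟨exists_quasiInverse_of_finite_finiteSupp, finite_finiteSupp_of_forall_exists_quasiInverse⟩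

theorem finite_supp_iff_forall_exists_quasiInverse {e : AdeleRing (𝓞 K) K} :
    (supp e).Finite ↔ ∀ y, ∃ z, e * (y * y * z) = e * y := by
  rw [finite_supp_iff, finite_finiteSupp_iff]
  constructor
  · intro h y
    obtain ⟨z, hz⟩ := h y.2
    refine ⟨(fun w => (y.1 w)⁻¹, z), Prod.ext (funext fun w => ?_) hz⟩
    change e.1 w * (y.1 w * y.1 w * (y.1 w)⁻¹) = e.1 w * y.1 w
    rw [mul_self_mul_inv]
  · intro h y
    -- The infinite component plays no role, so `0` will do.
    obtain ⟨z, hz⟩ := h (0, y)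
    exact ⟨z.2, congrArg Prod.snd hz⟩

end AdelicIdempotents

theorem theorem3p2 :
    (∃ φ : FirstOrder.Language.ring.Formula (Fin 1),
      FirstOrder.Language.BoundedFormula.IsExistsForallExists φ ∧
      ∀ (K : Type u) [Field K] [NumberField K],
        FirstOrder.Ring.Defines φ (NumberField.AdeleRing (NumberField.RingOfIntegers K) K)
          {a | ∃ h : IsIdempotentElem a, ⟨a, h⟩ ∈ AdelicIdempotents.fin K}) ∧
    (∃ ψ : FirstOrder.Language.ring.Formula (Fin 1),
      FirstOrder.Language.BoundedFormula.IsExistsForallExists ψ ∧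
      ∀ (K : Type u) [Field K] [NumberField K],
        FirstOrder.Ring.Defines ψ
          (IsDedekindDomain.FiniteAdeleRing (NumberField.RingOfIntegers K) K)
          {a | ∃ h : IsIdempotentElem a, ⟨a, h⟩ ∈ AdelicIdempotents.finFinite K}) := by
  refine ⟨⟨AdelicIdempotents.vonNeumannRegularFormula,
      AdelicIdempotents.isExistsForallExists_vonNeumannRegularFormula, fun K _ _ a => ?_⟩,
    ⟨AdelicIdempotents.vonNeumannRegularFormula,
      AdelicIdempotents.isExistsForallExists_vonNeumannRegularFormula, fun K _ _ a => ?_⟩⟩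
  · refine (AdelicIdempotents.defines_vonNeumannRegularFormula _ a).trans ?_
    rw [Set.mem_ofPred_eq, ← AdelicIdempotents.finite_supp_iff_forall_exists_quasiInverse]
    exact exists_prop.symm
  · refine (AdelicIdempotents.defines_vonNeumannRegularFormula _ a).trans ?_
    rw [Set.mem_ofPred_eq, ← AdelicIdempotents.finite_finiteSupp_iff]
    exact exists_prop.symm
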